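/- Let $m,n$ be non-negative integers, let $E\in\mathbb{R}^{m\times n}$ be a matrix with no zero column, let $S\subseteq\{1,\dots,n\}$ with complement $S^c$, and let $\lambda>0$. Put $$\mathcal{X}=\{x\in\mathbb{R}^n : x_i\ge 0 \text{ for every } i\in S^c\},\qquad f_2(x)=x^TE^TEx-\sum_{i\in S^c}\log x_i+\lambda\sum_{i\in S}|x_i| ,$$ where $-\log 0=+\infty$, so that $f_2:\mathcal{X}\to\mathbb{R}\cup\{+\infty\}$. Assume (A5)*: for every $\xi\in\mathbb{R}$ there is $\xi^*>0$ such that every $x\in\mathcal{X}$ with $f_2(x)\le\xi$ satisfies $1/\xi^*\le x_i\le\xi^*$ for all $i\in S^c$ and $|x_i|\le\xi^*$ for all $i\in S$. Let $z^0\in\mathcal{X}$ with $f_2(z^0)<\infty$. Cyclic coordinatewise minimization of $f_2$ started at $z^0$ produces, for $r=0,1,2,\dots$, the points $z^{r,0}=z^r$, $$z^{r,i}=\operatorname{arg\,min}\{f_2(x) : x\in\mathcal{X},\ x_j=z^{r,i-1}_j \text{ for all } j\ne i\}\qquad(i=1,\dots,n),$$ and $z^{r+1}=z^{r,n}$. Then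 these iterates are well defined (each minimum is attained at exactly one point), and the sequence $(z^r)_{r\ge0}$ converges to a point $z^*\in\mathcal{X}$ such that $f_2(z^*)\le f_2(x)$ for every $x\in\mathcal{X}$. -/

import Mathlib

open Filter Topology Matrix

namespace CCM

/-- The extended-real valued function `u ↦ -log u`, with value `+∞` for `u ≤ 0`. -/
noncomputable def negLog (u : ℝ) : EReal :=
  if 0 < u then ((-Real.log u : ℝ) : EReal) else ⊤

/-- The constraint set `𝒳 = {x ∈ ℝⁿ : xᵢ ≥ 0 for every i ∈ Sᶜ}`. -/
def feasible {n : ℕ} (S : Finset (Fin n)) : Set (Fin n → ℝ) :=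
  {x | ∀ i ∈ Sᶜ, 0 ≤ x i}

/-- The objective function `f₂(x) = xᵀEᵀEx - ∑_{i ∈ Sᶜ} log xᵢ + lam ∑_{i ∈ S} |xᵢ|`, which is
`+∞` as soon as `xᵢ = 0` for some `i ∈ Sᶜ`. It never takes the value `-∞`. -/
noncomputable def f₂ {m n : ℕ} (E : Matrix (Fin m) (Fin n) ℝ) (S : Finset (Fin n)) (lam : ℝ)
    (x : Fin n → ℝ) : EReal :=
  ((x ⬝ᵥ ((Eᵀ * E) *ᵥ x) : ℝ) : EReal) + ∑ i ∈ Sᶜ, negLog (x i)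
    + ((lam * ∑ i ∈ S, |x i| : ℝ) : EReal)

/-- Assumption (A5)*: on every sublevel set of `f₂` in `𝒳`, the coordinates are bounded, and those
in `Sᶜ` are also bounded away from `0`. -/
def LevelSetsBounded {m n : ℕ} (E : Matrix (Fin m) (Fin n) ℝ) (S : Finset (Fin n))
    (lam : ℝ) : Prop :=
  ∀ ξ : ℝ, ∃ ξ' : ℝ, 0 < ξ' ∧ ∀ x ∈ feasible S, f₂ E S lam x ≤ (ξ : EReal) →
    (∀ i ∈ Sᶜ, 1 / ξ' ≤ x i ∧ x i ≤ ξ') ∧ ∀ i ∈ S, |x i| ≤ ξ'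

/-- The points of `𝒳` that agree with `y` except possibly in coordinate `i`. -/
def coordSlice {n : ℕ} (S : Finset (Fin n)) (y : Fin n → ℝ) (i : Fin n) : Set (Fin n → ℝ) :=
  {x | x ∈ feasible S ∧ ∀ j, j ≠ i → x j = y j}

/-- `z` is the array of iterates of cyclic coordinatewise minimization of `f₂` started at `z₀`:
`z r k` is the iterate `z^{r,k}` (sweep `r`, after `k` of the `n` coordinate updates), so that
`z r 0` is the iterate `z^r`. -/
structure IsIterates {m n : ℕ} (E : Matrix (Fin m) (Fin n) ℝ) (S : Finset (Fin n)) (lam : ℝ)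
    (z₀ : Fin n → ℝ) (z : ℕ → Fin (n + 1) → (Fin n → ℝ)) : Prop where
  start : z 0 0 = z₀
  update_mem : ∀ (r : ℕ) (i : Fin n), z r i.succ ∈ coordSlice S (z r i.castSucc) i
  update_min : ∀ (r : ℕ) (i : Fin n),
    IsMinOn (f₂ E S lam) (coordSlice S (z r i.castSucc) i) (z r i.succ)
  next_sweep : ∀ r : ℕ, z (r + 1) 0 = z r (Fin.last n)

end CCM

/-! On its domain `f₂` is `‖A x‖ ^ 2 + ∑ i, φ i (x i)` with `A` linear and every `φ i` convex. The
proof shows that the gap `a r` to the minimum decays geometrically. Three estimates carry it.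

Nonzero columns give quadratic growth along each coordinate, so a sweep lowers the objective by at
least `c * step ^ 2` (`IsSweep.sufficient_decrease`). Coordinatewise optimality bounds the new gap
by `B * step * dist`, with `dist` the distance to any chosen minimizer (`IsSweep.gap_le`). The error
bound `dist ^ 2 ≤ C * gap` holds for a suitable minimizer (`exists_error_bound`). Together they give
`a (r + 1) ≤ M * (a r - a (r + 1))`, so the steps are summable and the iterates are Cauchy
(`tendsto_of_isSweep`).

The error bound is the delicate point, because `A` need not be injective and minimizers need not be
unique. It combines growth of each one-dimensional slack on a bounded box with a Hoffman-type bound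
(`exists_scaling_norm_le`). (A5)* supplies the box and the existence of minimizers. -/

namespace CCM

/-! ### A Hoffman-type bound for linear maps -/

section Scaling

variable {ι H : Type*} [Fintype ι] [NormedAddCommGroup H] [NormedSpace ℝ H]

/-- A linear map that is injective at `0` on a closed cone is bounded below on it. -/
theorem exists_norm_le_of_cone (A : (ι → ℝ) →L[ℝ] H) {K : Set (ι → ℝ)} (hK : IsClosed K)
    (hsmul : ∀ u ∈ K, ∀ t : ℝ, 0 ≤ t → t • u ∈ K) (hinj : ∀ u ∈ K, A u = 0 → u = 0) :
    ∃ c : ℝ, 0 ≤ c ∧ ∀ u ∈ K, ‖u‖ ≤ c * ‖A u‖ := by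
  have hcomp : IsCompact (Metric.sphere (0 : ι → ℝ) 1 ∩ K) :=
    (isCompact_sphere 0 1).inter_right hK
  have hnormalize : ∀ u ∈ K, u ≠ 0 → ‖u‖⁻¹ • u ∈ Metric.sphere (0 : ι → ℝ) 1 ∩ K := by
    intro u hu hu0
    refine ⟨?_, hsmul u hu _ (by positivity)⟩
    rw [mem_sphere_zero_iff_norm, norm_smul, norm_inv, norm_norm,
      inv_mul_cancel₀ (norm_ne_zero_iff.2 hu0)]
  rcases (Metric.sphere (0 : ι → ℝ) 1 ∩ K).eq_empty_or_nonempty with hemp | hne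
  · refine ⟨0, le_rfl, fun u hu => ?_⟩
    by_cases hu0 : u = 0
    · simp [hu0]
    · have := hnormalize u hu hu0
      rw [hemp] at this
      exact this.elim
  · obtain ⟨v, hv, hmin⟩ := hcomp.exists_isMinOn hne (f := fun u => ‖A u‖) (by fun_prop)
    have hv0 : v ≠ 0 := by
      rintro rfl
      simpa using hv.1
    have hpos : 0 < ‖A v‖ := norm_pos_iff.2 fun h => hv0 (hinj v hv.2 h)
    refine ⟨‖A v‖⁻¹, by positivity, fun u hu => ?_⟩
    by_cases hu0 : u = 0
    · simp [hu0]
    have hun : 0 < ‖u‖ := norm_pos_iff.2 hu0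
    have h : ‖A v‖ ≤ ‖A (‖u‖⁻¹ • u)‖ := hmin (hnormalize u hu hu0)
    rw [map_smul, norm_smul, norm_inv, norm_norm, inv_mul_eq_div, le_div_iff₀ hun] at h
    rwa [inv_mul_eq_div, le_div_iff₀ hpos, mul_comm]

/-- A Hoffman-type bound: every vector `d` can be shrunk coordinatewise, without changing its image
under `A`, to a vector whose norm is controlled by that image. -/
theorem exists_scaling_norm_le (A : (ι → ℝ) →L[ℝ] H) :
    ∃ C : ℝ, 0 ≤ C ∧ ∀ d : ι → ℝ, ∃ θ : ι → ℝ, (∀ i, 0 ≤ θ i ∧ θ i ≤ 1) ∧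
      A (θ * d) = A d ∧ ‖θ * d‖ ≤ C * ‖A d‖ := by
  classical
  let K : (ι → SignType) → Set (ι → ℝ) := fun σ =>
    {u | ∀ i, (σ i = 0 → u i = 0) ∧ 0 ≤ (σ i : ℝ) * u i}
  have hbound : ∀ σ, ∃ c : ℝ, 0 ≤ c ∧
      ((∀ u ∈ K σ, A u = 0 → u = 0) → ∀ u ∈ K σ, ‖u‖ ≤ c * ‖A u‖) := by
    intro σ
    by_cases hinj : ∀ u ∈ K σ, A u = 0 → u = 0
    · have hcl : IsClosed (K σ) := by
        simp only [K, Set.ofPred_forall, Set.ofPred_and]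
        refine isClosed_iInter fun i => IsClosed.inter ?_ ?_
        · refine isClosed_iInter fun _ => ?_
          exact isClosed_eq (continuous_apply i) continuous_const
        · exact isClosed_le continuous_const (by fun_prop)
      obtain ⟨c, hc, h⟩ := exists_norm_le_of_cone A hcl (fun u hu t ht i =>
        ⟨fun h => by simp [(hu i).1 h], by
          have := mul_nonneg ht (hu i).2
          simp only [Pi.smul_apply, smul_eq_mul]
          linarith⟩) hinj
      exact ⟨c, hc, fun _ => h⟩
    · exact ⟨0, le_rfl, fun h => (hinj h).elim⟩
  choose c hc hcK using hbound
  refine ⟨∑ σ, c σ, Finset.sum_nonneg fun σ _ => hc σ, fun d => ?_⟩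
  have hcomp : IsCompact (Set.Icc (0 : ι → ℝ) 1 ∩ {θ | A (θ * d) = A d}) :=
    isCompact_Icc.inter_right (isClosed_eq (by fun_prop) continuous_const)
  -- Minimality of `∑ i, θ i` leaves no kernel direction in the sign cone of `θ * d`. There are
  -- finitely many such cones, so one constant serves all `d`.
  obtain ⟨θ, ⟨hθ, hAθ⟩, hmin⟩ := hcomp.exists_isMinOn
    ⟨1, ⟨zero_le_one, le_rfl⟩, by simp⟩ (f := fun θ => ∑ i, θ i) (by fun_prop)
  have hAθ' : A (θ * d) = A d := hAθ
  refine ⟨θ, fun i => ⟨hθ.1 i, hθ.2 i⟩, hAθ, ?_⟩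
  let σ : ι → SignType := fun i => SignType.sign (θ i * d i)
  have hmem : θ * d ∈ K σ := fun i =>
    ⟨fun h => sign_eq_zero_iff.1 h, by simpa [σ] using by positivity⟩
  -- A nonzero kernel vector `u` in the cone has `u i / d i ≥ 0`, so replacing `θ` by `θ - t * (u /
  -- d)` for small `t > 0` keeps the image and lowers the sum.
  have hinj : ∀ u ∈ K σ, A u = 0 → u = 0 := by
    intro u hu hAu
    by_contra hu0
    obtain ⟨j, hj⟩ := Function.ne_iff.1 hu0
    have hsupp : ∀ i, u i ≠ 0 → 0 < θ i * (u i / d i) ∧ 0 < θ i := by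
      intro i hi
      have h0 : θ i * d i ≠ 0 := fun h => hi ((hu i).1 (by simp [σ, h]))
      have hθi : 0 < θ i := (hθ.1 i).lt_of_ne' (left_ne_zero_of_mul h0)
      have hdi : d i ≠ 0 := right_ne_zero_of_mul h0
      have hs := (hu i).2
      refine ⟨mul_pos hθi ?_, hθi⟩
      rcases lt_or_gt_of_ne hdi with hd | hd
      · have : σ i = -1 := sign_neg (mul_neg_of_pos_of_neg hθi hd)
        rw [this] at hs
        have hu' : u i < 0 := by
          refine lt_of_le_of_ne ?_ hi
          simpa using hs
        exact div_pos_of_neg_of_neg hu' hd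
      · have : σ i = 1 := sign_pos (mul_pos hθi hd)
        rw [this] at hs
        have hu' : 0 < u i := by
          refine lt_of_le_of_ne ?_ hi.symm
          simpa using hs
        exact div_pos hu' hd
    have hq : ∀ i, 0 ≤ u i / d i := by
      intro i
      by_cases hi : u i = 0
      · simp [hi]
      · exact (pos_of_mul_pos_right (hsupp i hi).1 (hsupp i hi).2.le).le
    have hev : ∀ᶠ t : ℝ in 𝓝[>] 0, ∀ i, 0 ≤ θ i - t * (u i / d i) := by
      refine eventually_all.2 fun i => ?_
      by_cases hi : u i = 0
      · exact Eventually.of_forall fun t => by simpa [hi] using hθ.1 i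
      · have hcont : Tendsto (fun t : ℝ => θ i - t * (u i / d i)) (𝓝[>] 0) (𝓝 (θ i)) := by
          have : Continuous fun t : ℝ => θ i - t * (u i / d i) := by fun_prop
          simpa using (this.tendsto 0).mono_left nhdsWithin_le_nhds
        filter_upwards [hcont.eventually (lt_mem_nhds (hsupp i hi).2)] with t ht using ht.le
    obtain ⟨t, ht, htpos⟩ := (hev.and self_mem_nhdsWithin).exists
    have htpos : 0 < t := htpos
    have hnew : (fun i => θ i - t * (u i / d i)) * d = θ * d - t • u := by
      ext i
      simp only [Pi.mul_apply, Pi.sub_apply, Pi.smul_apply, smul_eq_mul]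
      by_cases hi : u i = 0
      · simp [hi]
      · have hdi : d i ≠ 0 := fun h => by simpa [h] using (hsupp i hi).1
        field_simp
    have hle := hmin (a := fun i => θ i - t * (u i / d i))
      ⟨⟨fun i => ht i, fun i => by
        have := hθ.2 i
        have := mul_nonneg htpos.le (hq i)
        simp only [Pi.one_apply] at *
        linarith⟩, by
        simp only [Set.mem_ofPred_eq]
        rw [hnew, map_sub, map_smul, hAu, smul_zero, sub_zero, hAθ']⟩
    simp only [Set.mem_ofPred_eq, Finset.sum_sub_distrib] at hle
    have hpos : 0 < ∑ i, t * (u i / d i) :=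
      Finset.sum_pos' (fun i _ => mul_nonneg htpos.le (hq i)) ⟨j, Finset.mem_univ j,
        mul_pos htpos (pos_of_mul_pos_right (hsupp j hj).1 (hsupp j hj).2.le)⟩
    linarith
  calc ‖θ * d‖ ≤ c σ * ‖A (θ * d)‖ := hcK σ hinj _ hmem
    _ ≤ (∑ σ, c σ) * ‖A d‖ := by
      rw [hAθ']
      gcongr
      exact Finset.single_le_sum (fun σ _ => hc σ) (Finset.mem_univ σ)

end Scaling

/-! ### Quadratic plus separable objectives and their error bound -/

section Composite

variable {n : ℕ} {H : Type*} [NormedAddCommGroup H] [InnerProductSpace ℝ H]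

/-- A quadratic function plus a separable function. -/
noncomputable def compositeObj (A : (Fin n → ℝ) →L[ℝ] H) (φ : Fin n → ℝ → ℝ) (x : Fin n → ℝ) : ℝ :=
  ‖A x‖ ^ 2 + ∑ i, φ i (x i)

/-- The first-order change of the composite objective when coordinate `i` of `x` becomes `s`. -/
noncomputable def slack (A : (Fin n → ℝ) →L[ℝ] H) (φ : Fin n → ℝ → ℝ) (x : Fin n → ℝ) (i : Fin n)
    (s : ℝ) : ℝ :=
  φ i s - φ i (x i) + 2 * inner ℝ (A x) (A (Pi.single i 1)) * (s - x i)

variable (A : (Fin n → ℝ) →L[ℝ] H) (φ : Fin n → ℝ → ℝ)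

theorem slack_self (x : Fin n → ℝ) (i : Fin n) : slack A φ x i (x i) = 0 := by simp [slack]

theorem map_eq_sum_single (v : Fin n → ℝ) : A v = ∑ i, v i • A (Pi.single i 1) := by
  conv_lhs => rw [pi_eq_sum_univ' v]
  rw [map_sum]
  refine Finset.sum_congr rfl fun i _ => ?_
  rw [map_smul]

/-- The square is expanded exactly around `x`, and its linear term is distributed over the
coordinates. No differentiability of `φ` is needed. -/
theorem compositeObj_sub (x y : Fin n → ℝ) :
    compositeObj A φ y - compositeObj A φ x = ‖A (y - x)‖ ^ 2 + ∑ i, slack A φ x i (y i) := by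
  have h1 : ∑ i, slack A φ x i (y i) =
      ∑ i, φ i (y i) - ∑ i, φ i (x i) + 2 * inner ℝ (A x) (A (y - x)) := by
    rw [map_eq_sum_single A (y - x), inner_sum, Finset.mul_sum, ← Finset.sum_sub_distrib,
      ← Finset.sum_add_distrib]
    refine Finset.sum_congr rfl fun i _ => ?_
    rw [slack, inner_smul_right, Pi.sub_apply]
    ring
  have h2 : ‖A y‖ ^ 2 = ‖A x‖ ^ 2 + 2 * inner ℝ (A x) (A (y - x)) + ‖A (y - x)‖ ^ 2 := by
    rw [← norm_add_sq_real, ← map_add, add_sub_cancel]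
  rw [h1, compositeObj, compositeObj, h2]
  ring

theorem compositeObj_update_sub (x : Fin n → ℝ) (i : Fin n) (s : ℝ) :
    compositeObj A φ (Function.update x i s) - compositeObj A φ x =
      ‖A (Pi.single i 1)‖ ^ 2 * (s - x i) ^ 2 + slack A φ x i s := by
  have h : Function.update x i s - x = (s - x i) • Pi.single i (1 : ℝ) := by
    ext j
    by_cases hj : j = i
    · subst hj; simp
    · simp [hj]
  rw [compositeObj_sub, h, map_smul, norm_smul, mul_pow, Real.norm_eq_abs, sq_abs, mul_comm,
    Finset.sum_eq_single i]
  · simp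
  · intro j _ hj
    simp [hj, slack_self]
  · simp

variable {A φ}

theorem convexOn_slack {x : Fin n → ℝ} {i : Fin n} {I : Set ℝ} (hφ : ConvexOn ℝ I (φ i)) :
    ConvexOn ℝ I (slack A φ x i) := by
  refine ⟨hφ.1, fun a ha b hb p q hp hq hpq => ?_⟩
  have h := hφ.2 ha hb hp hq hpq
  simp only [slack, smul_eq_mul] at h ⊢
  obtain rfl : q = 1 - p := by linarith
  linarith

/-- At a minimizer along a coordinate direction, the first-order change is nonnegative. -/
theorem slack_nonneg {x : Fin n → ℝ} {i : Fin n} {I : Set ℝ} (hφ : ConvexOn ℝ I (φ i))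
    (hx : x i ∈ I)
    (hmin : ∀ s ∈ I, compositeObj A φ x ≤ compositeObj A φ (Function.update x i s))
    {s : ℝ} (hs : s ∈ I) : 0 ≤ slack A φ x i s := by
  -- Along the segment from `x i` to `s` the slack is at most `t` times its end value, while the
  -- quadratic term is of order `t ^ 2`. Divide by `t` and let `t → 0`.
  have key : ∀ t : ℝ, 0 < t → t ≤ 1 →
      0 ≤ t * (‖A (Pi.single i 1)‖ ^ 2 * (s - x i) ^ 2) + slack A φ x i s := by
    intro t ht ht1
    have hconv := (convexOn_slack (A := A) (x := x) hφ).2 hx hs (sub_nonneg.2 ht1) ht.le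
      (by ring)
    have hmem := hφ.1 hx hs (sub_nonneg.2 ht1) ht.le (by ring)
    have h := compositeObj_update_sub A φ x i ((1 - t) • x i + t • s)
    have h' := hmin _ hmem
    simp only [smul_eq_mul, slack_self] at hconv h h'
    have hsq : ((1 - t) * x i + t * s - x i) ^ 2 = t * (t * (s - x i) ^ 2) := by ring
    rw [hsq] at h
    refine (mul_nonneg_iff_of_pos_left ht).1 ?_
    linarith
  have hlim : Tendsto (fun t : ℝ => t * (‖A (Pi.single i 1)‖ ^ 2 * (s - x i) ^ 2)
      + slack A φ x i s) (𝓝[>] 0) (𝓝 (slack A φ x i s)) := by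
    have : Continuous fun t : ℝ => t * (‖A (Pi.single i 1)‖ ^ 2 * (s - x i) ^ 2)
      + slack A φ x i s := by fun_prop
    simpa using (this.tendsto 0).mono_left nhdsWithin_le_nhds
  refine ge_of_tendsto hlim ?_
  filter_upwards [Ioc_mem_nhdsGT (zero_lt_one' ℝ)] with t ht using key t ht.1 ht.2

/-- At a minimizer over a product set, all first-order changes are nonnegative. -/
theorem slack_nonneg_of_isMin {I : Fin n → Set ℝ} {x₀ : Fin n → ℝ}
    (hφ : ∀ i, ConvexOn ℝ (I i) (φ i)) (hx₀ : ∀ i, x₀ i ∈ I i)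
    (hmin : ∀ x : Fin n → ℝ, (∀ i, x i ∈ I i) → compositeObj A φ x₀ ≤ compositeObj A φ x)
    {i : Fin n} {s : ℝ} (hs : s ∈ I i) : 0 ≤ slack A φ x₀ i s :=
  slack_nonneg (hφ i) (hx₀ i) (fun t ht => hmin _ fun j => by
    by_cases hj : j = i
    · subst hj; simpa using ht
    · simpa [hj] using hx₀ j) hs

/-- Quadratic growth of the objective along a coordinate direction from a minimizer. -/
theorem compositeObj_add_le_update {x : Fin n → ℝ} {i : Fin n} {I : Set ℝ}
    (hφ : ConvexOn ℝ I (φ i)) (hx : x i ∈ I)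
    (hmin : ∀ s ∈ I, compositeObj A φ x ≤ compositeObj A φ (Function.update x i s))
    {s : ℝ} (hs : s ∈ I) :
    compositeObj A φ x + ‖A (Pi.single i 1)‖ ^ 2 * (s - x i) ^ 2 ≤
      compositeObj A φ (Function.update x i s) := by
  have := slack_nonneg hφ hx hmin hs
  have := compositeObj_update_sub A φ x i s
  linarith

theorem sq_norm_le_sum_sq (v : Fin n → ℝ) : ‖v‖ ^ 2 ≤ ∑ i, v i ^ 2 := by
  have h : ‖v‖ ≤ √(∑ i, v i ^ 2) := by
    refine (pi_norm_le_iff_of_nonneg (Real.sqrt_nonneg _)).2 fun i => ?_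
    rw [Real.norm_eq_abs, ← Real.sqrt_sq_eq_abs]
    exact Real.sqrt_le_sqrt (Finset.single_le_sum (f := fun i => v i ^ 2)
      (fun i _ => sq_nonneg _) (Finset.mem_univ i))
  calc ‖v‖ ^ 2 ≤ √(∑ i, v i ^ 2) ^ 2 := by gcongr
    _ = _ := Real.sq_sqrt (Finset.sum_nonneg fun i _ => sq_nonneg _)

/-- A global error bound from error bounds in each coordinate: the squared distance to the set of
minimizers is controlled by the gap in the objective. -/
theorem exists_error_bound {I D : Fin n → Set ℝ} {x₀ : Fin n → ℝ}
    (hφ : ∀ i, ConvexOn ℝ (I i) (φ i)) (hx₀ : ∀ i, x₀ i ∈ I i)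
    (hslack : ∀ i, ∀ s ∈ I i, 0 ≤ slack A φ x₀ i s)
    (hgrow : ∀ i, ∃ K : ℝ, 0 ≤ K ∧ ∀ s ∈ D i, ∃ s' ∈ I i, slack A φ x₀ i s' = 0 ∧
      (s - s') ^ 2 ≤ K * slack A φ x₀ i s) :
    ∃ C : ℝ, 0 ≤ C ∧ ∀ x : Fin n → ℝ, (∀ i, x i ∈ D i ∧ x i ∈ I i) →
      ∃ y : Fin n → ℝ, (∀ i, y i ∈ I i) ∧ compositeObj A φ y = compositeObj A φ x₀ ∧
        ‖x - y‖ ^ 2 ≤ C * (compositeObj A φ x - compositeObj A φ x₀) := by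
  choose K hK hKs using hgrow
  obtain ⟨C, hC, hscale⟩ := exists_scaling_norm_le A
  set κ := ∑ i, K i with hκ
  have hκ0 : 0 ≤ κ := Finset.sum_nonneg fun i _ => hK i
  refine ⟨2 * (1 + C * ‖A‖) ^ 2 * κ + 2 * C ^ 2, by positivity, fun x hx => ?_⟩
  choose x' hx'I hx's hx'd using fun i => hKs i (x i) (hx i).1
  -- The point `x'` has zero slacks but possibly the wrong image under `A`. Moving it coordinatewise
  -- towards `x₀` repairs the image, and convexity keeps the slacks zero between `x' i` and `x₀ i`.
  obtain ⟨θ, hθ, hAθ, hθn⟩ := hscale (x₀ - x')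
  have hgap := compositeObj_sub A φ x₀ x
  have hsl : ∀ i, 0 ≤ slack A φ x₀ i (x i) := fun i => hslack i _ (hx i).2
  have hyeq : ∀ i, (x' + θ * (x₀ - x')) i = (1 - θ i) • x' i + θ i • x₀ i := fun i => by
    simp only [Pi.add_apply, Pi.mul_apply, Pi.sub_apply, smul_eq_mul]; ring
  have hyI : ∀ i, (x' + θ * (x₀ - x')) i ∈ I i := fun i => by
    rw [hyeq]
    exact (hφ i).1 (hx'I i) (hx₀ i) (sub_nonneg.2 (hθ i).2) (hθ i).1 (by ring)
  refine ⟨x' + θ * (x₀ - x'), hyI, ?_, ?_⟩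
  · have h1 : A (x' + θ * (x₀ - x') - x₀) = 0 := by
      rw [map_sub, map_add, hAθ, map_sub]; abel
    have h2 : ∀ i, slack A φ x₀ i ((x' + θ * (x₀ - x')) i) = 0 := fun i => by
      refine le_antisymm ?_ (hslack i _ (hyI i))
      rw [hyeq]
      have := (convexOn_slack (A := A) (x := x₀) (hφ i)).2 (hx'I i) (hx₀ i)
        (sub_nonneg.2 (hθ i).2) (hθ i).1 (by ring)
      simpa [slack_self, hx's] using this
    have h := compositeObj_sub A φ x₀ (x' + θ * (x₀ - x'))
    rw [h1, Finset.sum_eq_zero fun i _ => h2 i] at h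
    simp only [norm_zero] at h
    linarith
  · have hd : ‖x - x'‖ ^ 2 ≤ κ * ∑ i, slack A φ x₀ i (x i) := by
      refine (sq_norm_le_sum_sq _).trans ?_
      rw [Finset.mul_sum]
      refine Finset.sum_le_sum fun i _ => (hx'd i).trans ?_
      exact mul_le_mul_of_nonneg_right
        (Finset.single_le_sum (fun i _ => hK i) (Finset.mem_univ i)) (hsl i)
    have hAd : ‖A (x₀ - x')‖ ≤ ‖A (x - x₀)‖ + ‖A‖ * ‖x - x'‖ := by
      have : A (x₀ - x') = A (x - x') - A (x - x₀) := by rw [← map_sub]; congr 1; abel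
      rw [this]
      refine (norm_sub_le _ _).trans ?_
      linarith [A.le_opNorm (x - x')]
    have hn : ‖x - (x' + θ * (x₀ - x'))‖ ≤
        (1 + C * ‖A‖) * ‖x - x'‖ + C * ‖A (x - x₀)‖ := by
      have : x - (x' + θ * (x₀ - x')) = (x - x') - θ * (x₀ - x') := by abel
      rw [this]
      refine (norm_sub_le _ _).trans ?_
      have := mul_le_mul_of_nonneg_left hAd hC
      linarith
    have hS : 0 ≤ ∑ i, slack A φ x₀ i (x i) := Finset.sum_nonneg fun i _ => hsl i
    rw [hgap]
    set S := ∑ i, slack A φ x₀ i (x i)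
    set a := ‖A (x - x₀)‖
    calc ‖x - (x' + θ * (x₀ - x'))‖ ^ 2
        ≤ ((1 + C * ‖A‖) * ‖x - x'‖ + C * a) ^ 2 := by gcongr
      _ ≤ 2 * ((1 + C * ‖A‖) * ‖x - x'‖) ^ 2 + 2 * (C * a) ^ 2 := by
        linarith [sq_nonneg ((1 + C * ‖A‖) * ‖x - x'‖ - C * a),
          add_sq ((1 + C * ‖A‖) * ‖x - x'‖) (C * a), sub_sq ((1 + C * ‖A‖) * ‖x - x'‖) (C * a)]
      _ = 2 * (1 + C * ‖A‖) ^ 2 * ‖x - x'‖ ^ 2 + 2 * C ^ 2 * a ^ 2 := by ring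
      _ ≤ 2 * (1 + C * ‖A‖) ^ 2 * (κ * S) + 2 * C ^ 2 * a ^ 2 := by gcongr
      _ ≤ (2 * (1 + C * ‖A‖) ^ 2 * κ + 2 * C ^ 2) * (a ^ 2 + S) := by
        have h1 : 0 ≤ 2 * (1 + C * ‖A‖) ^ 2 * κ * a ^ 2 := by positivity
        have h2 : 0 ≤ 2 * C ^ 2 * S := by positivity
        linarith

end Composite

/-! ### Linear convergence of cyclic sweeps -/

section Sweep

variable {n : ℕ} {H : Type*} [NormedAddCommGroup H] [InnerProductSpace ℝ H]

/-- One cyclic sweep `w 0, …, w n` of coordinatewise minimization over the product of the sets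
`I i`. -/
structure IsSweep (A : (Fin n → ℝ) →L[ℝ] H) (φ : Fin n → ℝ → ℝ) (I : Fin n → Set ℝ)
    (w : Fin (n + 1) → Fin n → ℝ) : Prop where
  mem : ∀ k i, w k i ∈ I i
  eq_of_ne : ∀ i j, j ≠ i → w i.succ j = w i.castSucc j
  le_update : ∀ i, ∀ s ∈ I i,
    compositeObj A φ (w i.succ) ≤ compositeObj A φ (Function.update (w i.succ) i s)

variable {A : (Fin n → ℝ) →L[ℝ] H} {φ : Fin n → ℝ → ℝ} {I : Fin n → Set ℝ}
  {w : Fin (n + 1) → Fin n → ℝ}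

theorem IsSweep.apply_of_le (hw : IsSweep A φ I w) (k : Fin (n + 1)) (j : Fin n)
    (hk : k ≤ j.castSucc) : w k j = w 0 j := by
  induction k using Fin.induction with
  | zero => rfl
  | succ i ih =>
    have hij : i < j := Fin.succ_le_castSucc_iff.1 hk
    rw [hw.eq_of_ne i j hij.ne', ih (by simpa using hij.le)]

theorem IsSweep.apply_of_lt (hw : IsSweep A φ I w) (k : Fin (n + 1)) (j : Fin n)
    (hk : j.castSucc < k) : w k j = w (Fin.last n) j := by
  have key : ∀ k : Fin (n + 1), j.castSucc < k → w k j = w j.succ j := by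
    intro k
    induction k using Fin.induction with
    | zero => exact fun h => absurd h (Fin.not_lt_zero _)
    | succ i ih =>
      intro h
      by_cases hij : j = i
      · rw [hij]
      · have hlt : j < i := lt_of_le_of_ne (Fin.castSucc_lt_succ_iff.1 h) hij
        rw [hw.eq_of_ne i j hij, ih (by simpa using hlt)]
  rw [key k hk, key _ (Fin.castSucc_lt_last j)]

/-- Each coordinate of `w k` is either already final or still initial, so each coordinate of the
difference is zero or that of the full step. The norm is the sup norm. -/
theorem IsSweep.norm_last_sub_le (hw : IsSweep A φ I w) (k : Fin (n + 1)) :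
    ‖w (Fin.last n) - w k‖ ≤ ‖w (Fin.last n) - w 0‖ := by
  refine (pi_norm_le_iff_of_nonneg (norm_nonneg _)).2 fun j => ?_
  rcases lt_or_ge j.castSucc k with h | h
  · simp [hw.apply_of_lt k j h]
  · rw [Pi.sub_apply, hw.apply_of_le k j h, ← Pi.sub_apply]
    exact norm_le_pi_norm _ j

theorem sum_castSucc_sub_succ (f : Fin (n + 1) → ℝ) :
    ∑ i : Fin n, (f i.castSucc - f i.succ) = f 0 - f (Fin.last n) := by
  rw [Finset.sum_sub_distrib]
  linarith [Fin.sum_univ_castSucc f, Fin.sum_univ_succ f]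

/-- A sweep decreases the objective by a multiple of the squared length of the step. -/
theorem IsSweep.sufficient_decrease (hw : IsSweep A φ I w) (hφ : ∀ i, ConvexOn ℝ (I i) (φ i))
    {c : ℝ} (hc : 0 ≤ c) (hcA : ∀ i, c ≤ ‖A (Pi.single i 1)‖ ^ 2) :
    c * ‖w (Fin.last n) - w 0‖ ^ 2 ≤
      compositeObj A φ (w 0) - compositeObj A φ (w (Fin.last n)) := by
  rw [← sum_castSucc_sub_succ fun k => compositeObj A φ (w k)]
  refine (mul_le_mul_of_nonneg_left (sq_norm_le_sum_sq _) hc).trans ?_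
  rw [Finset.mul_sum]
  refine Finset.sum_le_sum fun i _ => ?_
  have h := compositeObj_add_le_update (hφ i) (hw.mem i.succ i) (hw.le_update i)
    (hw.mem i.castSucc i)
  have hup : Function.update (w i.succ) i (w i.castSucc i) = w i.castSucc := by
    ext j
    by_cases hj : j = i
    · subst hj; simp
    · simp [hj, hw.eq_of_ne i j hj]
  rw [hup, hw.apply_of_le i.castSucc i le_rfl,
    hw.apply_of_lt i.succ i (Fin.castSucc_lt_succ)] at h
  have h2 : c * (w (Fin.last n) i - w 0 i) ^ 2 ≤
      ‖A (Pi.single i 1)‖ ^ 2 * (w 0 i - w (Fin.last n) i) ^ 2 := by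
    rw [← neg_sq (w 0 i - _), neg_sub]
    exact mul_le_mul_of_nonneg_right (hcA i) (sq_nonneg _)
  rw [Pi.sub_apply]
  linarith

/-- The gap in the objective after a sweep is controlled by the length of the step. -/
theorem IsSweep.gap_le (hw : IsSweep A φ I w) (hφ : ∀ i, ConvexOn ℝ (I i) (φ i))
    {y : Fin n → ℝ} (hy : ∀ i, y i ∈ I i) :
    compositeObj A φ (w (Fin.last n)) - compositeObj A φ y ≤
      (∑ i, 2 * ‖A‖ * ‖A (Pi.single i 1)‖) * ‖w (Fin.last n) - w 0‖ * ‖w (Fin.last n) - y‖ := by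
  set x := w (Fin.last n) with hx
  have hgap := compositeObj_sub A φ x y
  have hterm : ∀ i, -(2 * ‖A‖ * ‖A (Pi.single i 1)‖ * (‖x - w 0‖ * ‖x - y‖)) ≤
      slack A φ x i (y i) := by
    intro i
    have hpos := slack_nonneg (hφ i) (hw.mem i.succ i) (hw.le_update i) (hy i)
    have hxi : w i.succ i = x i := hw.apply_of_lt i.succ i Fin.castSucc_lt_succ
    -- Coordinate `i` is final after its own update, so the slacks at `x` and at `w i.succ` differ
    -- only in the gradient term.
    have hdiff : slack A φ x i (y i) = slack A φ (w i.succ) i (y i) +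
        2 * (inner ℝ (A (x - w i.succ)) (A (Pi.single i 1)) * (y i - x i)) := by
      rw [slack, slack, hxi, map_sub, inner_sub_left]
      ring
    have habs : |inner ℝ (A (x - w i.succ)) (A (Pi.single i 1)) * (y i - x i)| ≤
        (‖A‖ * ‖x - w 0‖) * ‖A (Pi.single i 1)‖ * ‖x - y‖ := by
      rw [abs_mul]
      gcongr
      · refine (abs_real_inner_le_norm _ _).trans ?_
        gcongr
        exact (A.le_opNorm _).trans (by gcongr; exact hw.norm_last_sub_le _)
      · rw [abs_sub_comm, ← Pi.sub_apply, ← Real.norm_eq_abs]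
        exact norm_le_pi_norm _ i
    have := neg_le_of_abs_le habs
    linarith
  have hsum := Finset.sum_le_sum fun i (_ : i ∈ Finset.univ) => hterm i
  rw [Finset.sum_neg_distrib, ← Finset.sum_mul] at hsum
  have := sq_nonneg ‖A (y - x)‖
  linarith

/-- Convergence of cyclic coordinatewise minimization of a quadratic plus separable function, under
error bounds in each coordinate. -/
theorem tendsto_of_isSweep {D : Fin n → Set ℝ} {x₀ : Fin n → ℝ} {Z : ℕ → Fin (n + 1) → Fin n → ℝ}
    (hφ : ∀ i, ConvexOn ℝ (I i) (φ i)) (hcont : ∀ i, ContinuousOn (φ i) (D i))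
    (hD : ∀ i, IsClosed (D i)) (hDI : ∀ i, D i ⊆ I i) (hA : ∀ i, A (Pi.single i 1) ≠ 0)
    (hx₀ : ∀ i, x₀ i ∈ I i)
    (hmin : ∀ x : Fin n → ℝ, (∀ i, x i ∈ I i) → compositeObj A φ x₀ ≤ compositeObj A φ x)
    (hgrow : ∀ i, ∃ K : ℝ, 0 ≤ K ∧ ∀ s ∈ D i, ∃ s' ∈ I i, slack A φ x₀ i s' = 0 ∧
      (s - s') ^ 2 ≤ K * slack A φ x₀ i s)
    (hZ : ∀ r, IsSweep A φ I (Z r)) (hnext : ∀ r, Z (r + 1) 0 = Z r (Fin.last n))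
    (hZD : ∀ r i, Z r 0 i ∈ D i) :
    ∃ x : Fin n → ℝ, (∀ i, x i ∈ D i) ∧ Tendsto (fun r => Z r 0) atTop (𝓝 x) ∧
      compositeObj A φ x = compositeObj A φ x₀ := by
  have hslack : ∀ i, ∀ s ∈ I i, 0 ≤ slack A φ x₀ i s := fun _ _ hs =>
    slack_nonneg_of_isMin hφ hx₀ hmin hs
  obtain ⟨C, hC, herr⟩ := exists_error_bound hφ hx₀ hslack hgrow
  obtain ⟨c, hc, hcA⟩ : ∃ c : ℝ, 0 < c ∧ ∀ i, c ≤ ‖A (Pi.single i 1)‖ ^ 2 := by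
    have hev : ∀ᶠ c : ℝ in 𝓝[>] 0, ∀ i, c ≤ ‖A (Pi.single i 1)‖ ^ 2 :=
      eventually_all.2 fun i => by
        have hi : (0 : ℝ) < ‖A (Pi.single i 1)‖ ^ 2 := by
          have := norm_pos_iff.2 (hA i)
          positivity
        filter_upwards [Ioc_mem_nhdsGT hi] with t ht using ht.2
    obtain ⟨c, h, hc⟩ := (hev.and self_mem_nhdsWithin).exists
    exact ⟨c, hc, h⟩
  set a : ℕ → ℝ := fun r => compositeObj A φ (Z r 0) - compositeObj A φ x₀ with ha
  set B := ∑ i, 2 * ‖A‖ * ‖A (Pi.single i 1)‖ with hB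
  have ha0 : ∀ r, 0 ≤ a r := fun r => sub_nonneg.2 (hmin _ ((hZ r).mem 0))
  have hdec : ∀ r, c * ‖Z (r + 1) 0 - Z r 0‖ ^ 2 ≤ a r - a (r + 1) := by
    intro r
    have h := (hZ r).sufficient_decrease hφ hc.le hcA
    rw [← hnext] at h
    simp only [ha]
    linarith
  set M := B ^ 2 * C / c with hM
  have hM0 : 0 ≤ M := by positivity
  have hlin : ∀ r, a (r + 1) ≤ M * (a r - a (r + 1)) := by
    intro r
    -- The main estimate bounds `a (r + 1) ^ 2`; a zero gap is set aside so that one factor can be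
    -- cancelled.
    rcases (ha0 (r + 1)).eq_or_lt with h0 | h0
    · rw [← h0]
      have := ha0 r
      exact mul_nonneg hM0 (by linarith)
    obtain ⟨y, hyI, hyQ, hyn⟩ := herr (Z (r + 1) 0) fun i => ⟨hZD _ i, hDI i (hZD _ i)⟩
    have hgap := (hZ r).gap_le hφ hyI
    rw [← hnext, hyQ] at hgap
    change a (r + 1) ≤ B * ‖Z (r + 1) 0 - Z r 0‖ * ‖Z (r + 1) 0 - y‖ at hgap
    change ‖Z (r + 1) 0 - y‖ ^ 2 ≤ C * a (r + 1) at hyn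
    have hstep : ‖Z (r + 1) 0 - Z r 0‖ ^ 2 ≤ (a r - a (r + 1)) / c := by
      rw [le_div_iff₀ hc, mul_comm]
      exact hdec r
    have hquot : 0 ≤ (a r - a (r + 1)) / c := (sq_nonneg _).trans hstep
    refine le_of_mul_le_mul_right ?_ h0
    calc a (r + 1) * a (r + 1) = a (r + 1) ^ 2 := by ring
      _ ≤ (B * ‖Z (r + 1) 0 - Z r 0‖ * ‖Z (r + 1) 0 - y‖) ^ 2 := by gcongr
      _ = B ^ 2 * ‖Z (r + 1) 0 - Z r 0‖ ^ 2 * ‖Z (r + 1) 0 - y‖ ^ 2 := by ring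
      _ ≤ B ^ 2 * ((a r - a (r + 1)) / c) * (C * a (r + 1)) := by gcongr
      _ = M * (a r - a (r + 1)) * a (r + 1) := by rw [hM]; ring
  -- Solving `a (r + 1) ≤ M * (a r - a (r + 1))` for `a (r + 1)` gives this ratio; step lengths,
  -- controlled through their squares, decay with ratio `√ρ`.
  set ρ := M / (1 + M) with hρ
  have hρ0 : 0 ≤ ρ := by positivity
  have hρ1 : ρ < 1 := by
    rw [hρ, div_lt_one (by positivity)]
    linarith
  have hgeom : ∀ r, a r ≤ a 0 * ρ ^ r := by
    intro r
    induction r with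
    | zero => simp
    | succ r ih =>
      have h : a (r + 1) ≤ ρ * a r := by
        rw [hρ, div_mul_eq_mul_div, le_div_iff₀ (by positivity)]
        linarith [hlin r]
      calc a (r + 1) ≤ ρ * a r := h
        _ ≤ ρ * (a 0 * ρ ^ r) := by gcongr
        _ = a 0 * ρ ^ (r + 1) := by ring
  have hstep : ∀ r, dist (Z r 0) (Z (r + 1) 0) ≤ √(a 0 / c) * √ρ ^ r := by
    intro r
    rw [dist_comm, dist_eq_norm]
    refine abs_le_of_sq_le_sq' ?_ (by positivity) |>.2
    rw [mul_pow, Real.sq_sqrt (div_nonneg (ha0 0) hc.le), ← pow_mul, mul_comm r, pow_mul,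
      Real.sq_sqrt hρ0, div_mul_eq_mul_div, le_div_iff₀ hc, mul_comm]
    linarith [hdec r, hgeom r, ha0 (r + 1)]
  have hcauchy : CauchySeq fun r => Z r 0 :=
    cauchySeq_of_le_geometric (√ρ) (√(a 0 / c))
      (by rw [Real.sqrt_lt' one_pos]; simpa using hρ1) hstep
  obtain ⟨x, hx⟩ := cauchySeq_tendsto_of_complete hcauchy
  have hxi : ∀ i, Tendsto (fun r => Z r 0 i) atTop (𝓝 (x i)) := tendsto_pi_nhds.1 hx
  have hxD : ∀ i, x i ∈ D i := fun i =>
    (hD i).mem_of_tendsto (hxi i) (Eventually.of_forall fun r => hZD r i)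
  refine ⟨x, hxD, hx, ?_⟩
  have hlimQ : Tendsto (fun r => compositeObj A φ (Z r 0)) atTop (𝓝 (compositeObj A φ x)) := by
    refine Tendsto.add (((A.continuous.tendsto x).comp hx).norm.pow 2)
      (tendsto_finsetSum _ fun i _ => ?_)
    exact (hcont i (x i) (hxD i)).tendsto.comp (tendsto_nhdsWithin_iff.2
      ⟨hxi i, Eventually.of_forall fun r => hZD r i⟩)
  have hlima : Tendsto a atTop (𝓝 0) := by
    refine squeeze_zero ha0 hgeom ?_
    simpa using (tendsto_pow_atTop_nhds_zero_of_lt_one hρ0 hρ1).const_mul (a 0)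
  exact sub_eq_zero.1 (tendsto_nhds_unique (hlimQ.sub_const _) hlima)

end Sweep

/-! ### Growth of the one-dimensional slacks -/

section Growth

theorem abs_growth {lam g a ξ : ℝ} (h : ∀ s, 0 ≤ lam * |s| - lam * |a| + g * (s - a)) :
    ∃ K : ℝ, 0 ≤ K ∧ ∀ s, |s| ≤ ξ → ∃ s', lam * |s'| - lam * |a| + g * (s' - a) = 0 ∧
      (s - s') ^ 2 ≤ K * (lam * |s| - lam * |a| + g * (s - a)) := by
  -- The function `lam * |s| + g * s` is positively homogeneous, so a minimizer `a` has value zero: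
  -- test at `0` and `2 * a`.
  have ha : lam * |a| + g * a = 0 := by
    have h0 := h 0
    have h2 := h (2 * a)
    rw [abs_zero] at h0
    rw [abs_mul, abs_two] at h2
    linarith
  have heq : ∀ s, lam * |s| - lam * |a| + g * (s - a) = lam * |s| + g * s := fun s => by linarith
  simp only [heq] at h ⊢
  have hp : 0 ≤ lam + g := by simpa using h 1
  have hm : 0 ≤ lam - g := by simpa [sub_eq_add_neg] using h (-1)
  -- On a half-line of zero slope take `s' = s`; the convention `0⁻¹ = 0` drops that slope from the
  -- constant. On one of positive slope take `s' = 0`.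
  refine ⟨|ξ| * ((lam + g)⁻¹ + (lam - g)⁻¹), by positivity, fun s hs => ?_⟩
  have hs' : |s| ≤ |ξ| := hs.trans (le_abs_self ξ)
  have main : ∀ q q' : ℝ, 0 < q → 0 ≤ q' → s ^ 2 ≤ |ξ| * (q⁻¹ + q'⁻¹) * (q * |s|) := by
    intro q q' hq hq'
    calc s ^ 2 = |s| * |s| := by rw [← sq, sq_abs]
      _ ≤ |ξ| * |s| := by gcongr
      _ = |ξ| * q⁻¹ * (q * |s|) := by field_simp
      _ ≤ |ξ| * (q⁻¹ + q'⁻¹) * (q * |s|) := by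
        gcongr
        exact le_add_of_nonneg_right (by positivity)
  rcases le_total 0 s with h0 | h0
  · have hval : lam * |s| + g * s = (lam + g) * |s| := by rw [abs_of_nonneg h0]; ring
    rcases hp.eq_or_lt with h1 | h1
    · exact ⟨s, by rw [hval, ← h1, zero_mul], by rw [hval, ← h1]; simp⟩
    · refine ⟨0, by simp, ?_⟩
      rw [hval, sub_zero]
      exact main _ _ h1 hm
  · have hval : lam * |s| + g * s = (lam - g) * |s| := by rw [abs_of_nonpos h0]; ring
    rcases hm.eq_or_lt with h1 | h1
    · exact ⟨s, by rw [hval, ← h1, zero_mul], by rw [hval, ← h1]; simp⟩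
    · refine ⟨0, by simp, ?_⟩
      rw [hval, sub_zero, add_comm (lam + g)⁻¹]
      exact main _ _ h1 hp

/-- Nonnegativity at the midpoint replaces the first-order condition at `a`. Subtracting twice the
midpoint value cancels the linear terms and leaves `log (((s + a) / 2) ^ 2 / (s * a))`, which `1 -
x⁻¹ ≤ log x` bounds below. -/
theorem neg_log_growth {g a s ξ : ℝ} (ha : 0 < a) (hs : 0 < s) (haξ : a ≤ ξ) (hsξ : s ≤ ξ)
    (h : ∀ t, 0 < t → 0 ≤ -Real.log t - -Real.log a + g * (t - a)) :
    (s - a) ^ 2 ≤ 4 * ξ ^ 2 * (-Real.log s - -Real.log a + g * (s - a)) := by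
  have hM := h ((s + a) / 2) (by positivity)
  have hlog := Real.one_sub_inv_le_log_of_pos (x := ((s + a) / 2) ^ 2 / (s * a)) (by positivity)
  rw [Real.log_div (by positivity) (by positivity), Real.log_pow,
    Real.log_mul hs.ne' ha.ne'] at hlog
  have hfrac : 1 - (((s + a) / 2) ^ 2 / (s * a))⁻¹ = (s - a) ^ 2 / (s + a) ^ 2 := by
    field_simp
    ring
  rw [hfrac, div_le_iff₀ (by positivity)] at hlog
  push_cast at hlog
  have hle : 2 * Real.log ((s + a) / 2) - (Real.log s + Real.log a) ≤
      -Real.log s - -Real.log a + g * (s - a) := by linarith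
  refine hlog.trans ?_
  rw [mul_comm]
  have hnn := h s hs
  calc (s + a) ^ 2 * _ ≤ (s + a) ^ 2 * (-Real.log s - -Real.log a + g * (s - a)) := by gcongr
    _ ≤ (ξ + ξ) ^ 2 * (-Real.log s - -Real.log a + g * (s - a)) := by gcongr
    _ = _ := by ring

end Growth

/-! ### Translation of `f₂` into a composite objective -/

variable {m n : ℕ} (E : Matrix (Fin m) (Fin n) ℝ) (S : Finset (Fin n)) (lam : ℝ)

/-- Multiplication by `E`, as a map into Euclidean space. -/
noncomputable def euclideanMulVec : (Fin n → ℝ) →L[ℝ] EuclideanSpace ℝ (Fin m) :=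
  LinearMap.toContinuousLinearMap ((WithLp.linearEquiv 2 ℝ (Fin m → ℝ)).symm ∘ₗ E.mulVecLin)

/-- The separable part of `f₂`. -/
noncomputable def penalty (i : Fin n) (s : ℝ) : ℝ :=
  if i ∈ S then lam * |s| else -Real.log s

/-- The domain on which `penalty` is finite. -/
def penaltyDomain (i : Fin n) : Set ℝ := if i ∈ S then Set.univ else Set.Ioi 0

/-- The bounds on coordinate `i` given by `LevelSetsBounded`. -/
def levelBox (ξ : ℝ) (i : Fin n) : Set ℝ :=
  if i ∈ S then Set.Icc (-ξ) ξ else Set.Icc (1 / ξ) ξ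

variable {E S lam}

theorem euclideanMulVec_apply (x : Fin n → ℝ) :
    euclideanMulVec E x = WithLp.toLp 2 (E *ᵥ x) := rfl

theorem norm_euclideanMulVec_sq (x : Fin n → ℝ) :
    ‖euclideanMulVec E x‖ ^ 2 = x ⬝ᵥ ((Eᵀ * E) *ᵥ x) := by
  rw [euclideanMulVec_apply, EuclideanSpace.real_norm_sq_eq, ← mulVec_mulVec, dotProduct_mulVec,
    vecMul_transpose]
  simp [dotProduct, sq]

theorem euclideanMulVec_single_ne_zero (hE : ∀ j : Fin n, ∃ i : Fin m, E i j ≠ 0) (j : Fin n) :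
    euclideanMulVec E (Pi.single j 1) ≠ 0 := by
  obtain ⟨i, hi⟩ := hE j
  intro h
  apply hi
  have := congrArg (fun v : EuclideanSpace ℝ (Fin m) => v i) h
  simpa [euclideanMulVec_apply] using this

theorem negLog_ne_bot (u : ℝ) : negLog u ≠ ⊥ := by
  unfold negLog
  split_ifs
  · exact EReal.coe_ne_bot _
  · exact top_ne_bot

/-- Since `⊤ + ⊥ = ⊥` in `EReal`, this is needed for a single infinite term to make the whole sum
infinite. -/
theorem sum_negLog_ne_bot (T : Finset (Fin n)) (x : Fin n → ℝ) : ∑ i ∈ T, negLog (x i) ≠ ⊥ := by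
  classical
  induction T using Finset.induction_on with
  | empty => simp
  | insert i T hi ih =>
    rw [Finset.sum_insert hi]
    exact EReal.add_ne_bot_iff.2 ⟨negLog_ne_bot _, ih⟩

theorem f₂_eq_coe {x : Fin n → ℝ} (hx : ∀ i, x i ∈ penaltyDomain S i) :
    f₂ E S lam x = (compositeObj (euclideanMulVec E) (penalty S lam) x : ℝ) := by
  have h1 : ∑ i ∈ Sᶜ, negLog (x i) = ((∑ i ∈ Sᶜ, penalty S lam i (x i) : ℝ) : EReal) := by
    rw [show ((∑ i ∈ Sᶜ, penalty S lam i (x i) : ℝ) : EReal) =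
      ∑ i ∈ Sᶜ, (penalty S lam i (x i) : EReal) from
      map_sum (⟨⟨Real.toEReal, rfl⟩, EReal.coe_add⟩ : ℝ →+ EReal) _ _]
    refine Finset.sum_congr rfl fun i hi => ?_
    have hi' : i ∉ S := Finset.mem_compl.1 hi
    have hxi : 0 < x i := by simpa [penaltyDomain, hi'] using hx i
    simp [negLog, penalty, hi', hxi]
  have h2 : lam * ∑ i ∈ S, |x i| = ∑ i ∈ S, penalty S lam i (x i) := by
    rw [Finset.mul_sum]
    exact Finset.sum_congr rfl fun i hi => by simp [penalty, hi]
  rw [f₂, h1, h2, compositeObj, norm_euclideanMulVec_sq, ← EReal.coe_add, ← EReal.coe_add,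
    ← Finset.sum_compl_add_sum S, add_assoc]

theorem f₂_lt_top_iff {x : Fin n → ℝ} :
    f₂ E S lam x < ⊤ ↔ ∀ i, x i ∈ penaltyDomain S i := by
  refine ⟨fun h i => ?_, fun h => by rw [f₂_eq_coe h]; exact EReal.coe_lt_top _⟩
  by_cases hi : i ∈ S
  · simp [penaltyDomain, hi]
  by_contra hxi
  have hneg : negLog (x i) = ⊤ := by
    have : ¬ 0 < x i := by simpa [penaltyDomain, hi] using hxi
    simp [negLog, this]
  have hsum : ∑ j ∈ Sᶜ, negLog (x j) = ⊤ := by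
    rw [← Finset.add_sum_erase _ _ (Finset.mem_compl.2 hi), hneg]
    exact EReal.top_add_of_ne_bot (sum_negLog_ne_bot _ _)
  rw [f₂, hsum, EReal.coe_add_top, EReal.top_add_coe] at h
  exact lt_irrefl _ h

theorem mem_feasible_of_domain {x : Fin n → ℝ} (hx : ∀ i, x i ∈ penaltyDomain S i) :
    x ∈ feasible S := fun i hi => by
  have := hx i
  rw [penaltyDomain, if_neg (Finset.mem_compl.1 hi)] at this
  exact le_of_lt this

theorem isClosed_feasible : IsClosed (feasible S) := by
  simp only [feasible, Set.ofPred_forall]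
  exact isClosed_iInter fun i => isClosed_iInter fun _ =>
    isClosed_le continuous_const (continuous_apply i)

theorem isClosed_coordSlice (y : Fin n → ℝ) (i : Fin n) : IsClosed (coordSlice S y i) := by
  refine isClosed_feasible.inter (s₂ := {x | ∀ j, j ≠ i → x j = y j}) ?_
  simp only [Set.ofPred_forall]
  exact isClosed_iInter fun j => isClosed_iInter fun _ =>
    isClosed_eq (continuous_apply j) continuous_const

theorem isCompact_levelBox (ξ : ℝ) (i : Fin n) : IsCompact (levelBox S ξ i) := by
  unfold levelBox
  split_ifs <;> exact isCompact_Icc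

theorem levelBox_subset {ξ : ℝ} (hξ : 0 < ξ) (i : Fin n) :
    levelBox S ξ i ⊆ penaltyDomain S i := by
  unfold levelBox penaltyDomain
  split_ifs
  · exact Set.subset_univ _
  · exact fun s hs => (one_div_pos.2 hξ).trans_le hs.1

theorem continuousOn_penalty (i : Fin n) :
    ContinuousOn (penalty S lam i) (penaltyDomain S i) := by
  unfold penaltyDomain penalty
  split_ifs
  · fun_prop
  · exact (Real.continuousOn_log.mono fun s hs => (ne_of_gt hs)).neg

theorem convexOn_penalty (hlam : 0 ≤ lam) (i : Fin n) :
    ConvexOn ℝ (penaltyDomain S i) (penalty S lam i) := by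
  unfold penaltyDomain penalty
  split_ifs
  · refine ⟨convex_univ, fun a _ b _ p q hp hq _ => ?_⟩
    simp only [smul_eq_mul]
    calc lam * |p * a + q * b| ≤ lam * (p * |a| + q * |b|) := by
          gcongr
          refine (abs_add_le _ _).trans ?_
          rw [abs_mul, abs_mul, abs_of_nonneg hp, abs_of_nonneg hq]
      _ = _ := by ring
  · exact strictConcaveOn_log_Ioi.concaveOn.neg

theorem LevelSetsBounded.exists_levelBox (h : LevelSetsBounded E S lam) (ξ : ℝ) :
    ∃ ξ' : ℝ, 0 < ξ' ∧ ∀ x ∈ feasible S, f₂ E S lam x ≤ (ξ : EReal) →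
      ∀ i, x i ∈ levelBox S ξ' i := by
  obtain ⟨ξ', hξ', hx⟩ := h ξ
  refine ⟨ξ', hξ', fun x hxf hle i => ?_⟩
  unfold levelBox
  split_ifs with hi
  · exact abs_le.1 ((hx x hxf hle).2 i hi)
  · exact (hx x hxf hle).1 i (Finset.mem_compl.2 hi)

/-- The part of `T` below the level of `y` lies in a compact box on which the objective is finite
and continuous. Points above that level are compared with `y`. This serves both the coordinate
updates and the global minimum. -/
theorem exists_isMinOn_f₂ (hA5 : LevelSetsBounded E S lam) {T : Set (Fin n → ℝ)}
    (hT : IsClosed T) (hTf : T ⊆ feasible S) {y : Fin n → ℝ} (hy : y ∈ T)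
    (hfin : f₂ E S lam y < ⊤) : ∃ w ∈ T, IsMinOn (f₂ E S lam) T w := by
  have hyI := f₂_lt_top_iff.1 hfin
  obtain ⟨ξ, hξ, hbox⟩ :=
    hA5.exists_levelBox (compositeObj (euclideanMulVec E) (penalty S lam) y)
  rw [← f₂_eq_coe hyI] at hbox
  have hcomp : IsCompact (T ∩ Set.univ.pi (levelBox S ξ)) :=
    (isCompact_univ_pi fun i => isCompact_levelBox ξ i).inter_left hT
  have hcont : ContinuousOn (compositeObj (euclideanMulVec E) (penalty S lam))
      (T ∩ Set.univ.pi (levelBox S ξ)) := by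
    refine ContinuousOn.add (by fun_prop) (continuousOn_finsetSum _ fun i _ => ?_)
    exact (continuousOn_penalty i).comp (continuous_apply i).continuousOn
      fun x hx => levelBox_subset hξ i (hx.2 i trivial)
  have hymem : y ∈ T ∩ Set.univ.pi (levelBox S ξ) :=
    ⟨hy, fun i _ => hbox y (hTf hy) le_rfl i⟩
  obtain ⟨w, hw, hmin⟩ := hcomp.exists_isMinOn ⟨y, hymem⟩ hcont
  have hle : ∀ x ∈ T ∩ Set.univ.pi (levelBox S ξ), f₂ E S lam w ≤ f₂ E S lam x := by
    intro x hx
    rw [f₂_eq_coe fun i => levelBox_subset hξ i (hw.2 i trivial),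
      f₂_eq_coe fun i => levelBox_subset hξ i (hx.2 i trivial)]
    exact EReal.coe_le_coe_iff.2 (hmin hx)
  refine ⟨w, hw.1, fun x hx => ?_⟩
  rcases le_total (f₂ E S lam x) (f₂ E S lam y) with h | h
  · exact hle x ⟨hx, fun i _ => hbox x (hTf hx) h i⟩
  · exact (hle y hymem).trans h

theorem self_mem_coordSlice {y : Fin n → ℝ} (hy : y ∈ feasible S) (i : Fin n) :
    y ∈ coordSlice S y i := ⟨hy, fun _ _ => rfl⟩

theorem le_update_of_isMinOn {y w : Fin n → ℝ} {i : Fin n}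
    (hw : w ∈ coordSlice S y i) (hmin : IsMinOn (f₂ E S lam) (coordSlice S y i) w)
    (hwI : ∀ j, w j ∈ penaltyDomain S j) {s : ℝ} (hs : s ∈ penaltyDomain S i) :
    compositeObj (euclideanMulVec E) (penalty S lam) w ≤
      compositeObj (euclideanMulVec E) (penalty S lam) (Function.update w i s) := by
  have hI : ∀ j, Function.update w i s j ∈ penaltyDomain S j := fun j => by
    by_cases hj : j = i
    · subst hj; simpa using hs
    · simpa [hj] using hwI j
  have h : f₂ E S lam w ≤ f₂ E S lam (Function.update w i s) :=
    hmin ⟨mem_feasible_of_domain hI, fun j hj => by simp [hj, hw.2 j hj]⟩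
  rwa [f₂_eq_coe hwI, f₂_eq_coe hI, EReal.coe_le_coe_iff] at h

/-- The absolute value is not strictly convex, so uniqueness comes from quadratic growth with the
positive factor `‖A e_i‖ ^ 2`, where `A` is `euclideanMulVec E`. -/
theorem isMinOn_coordSlice_unique (hlam : 0 ≤ lam) (hE : ∀ j : Fin n, ∃ i : Fin m, E i j ≠ 0)
    {y w w' : Fin n → ℝ} {i : Fin n} (hy : y ∈ feasible S) (hfin : f₂ E S lam y < ⊤)
    (hw : w ∈ coordSlice S y i) (hmin : IsMinOn (f₂ E S lam) (coordSlice S y i) w)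
    (hw' : w' ∈ coordSlice S y i) (hmin' : IsMinOn (f₂ E S lam) (coordSlice S y i) w') :
    w' = w := by
  have hwI := f₂_lt_top_iff.1 ((hmin (self_mem_coordSlice hy i)).trans_lt hfin)
  have hwI' := f₂_lt_top_iff.1 ((hmin' (self_mem_coordSlice hy i)).trans_lt hfin)
  have hup : Function.update w i (w' i) = w' := by
    ext j
    by_cases hj : j = i
    · subst hj; simp
    · simp [hj, hw.2 j hj, hw'.2 j hj]
  have hgrow := compositeObj_add_le_update (convexOn_penalty hlam i) (hwI i)
    (fun s hs => le_update_of_isMinOn hw hmin hwI hs) (hwI' i)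
  have hle : f₂ E S lam w' ≤ f₂ E S lam w := hmin' hw
  rw [f₂_eq_coe hwI, f₂_eq_coe hwI', EReal.coe_le_coe_iff] at hle
  rw [hup] at hgrow
  have hpos : 0 < ‖euclideanMulVec E (Pi.single i 1)‖ ^ 2 := by
    have := norm_pos_iff.2 (euclideanMulVec_single_ne_zero hE i)
    positivity
  have hsq : (w' i - w i) ^ 2 ≤ 0 := by
    by_contra! h
    have := mul_pos hpos h
    linarith
  have heq : w' i = w i := sub_eq_zero.1 (pow_eq_zero_iff two_ne_zero |>.1
    (le_antisymm hsq (sq_nonneg _)))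
  rw [← hup, heq, Function.update_eq_self]

/-! ### The iterates: well-definedness and level sets -/

section Iterates

variable {z₀ : Fin n → ℝ} {z : ℕ → Fin (n + 1) → Fin n → ℝ}

theorem IsIterates.feasible_and_le (hz : IsIterates E S lam z₀ z) (hz₀ : z₀ ∈ feasible S) (r : ℕ)
    (k : Fin (n + 1)) : z r k ∈ feasible S ∧ f₂ E S lam (z r k) ≤ f₂ E S lam z₀ := by
  have sweep : ∀ r, (z r 0 ∈ feasible S ∧ f₂ E S lam (z r 0) ≤ f₂ E S lam z₀) →
      ∀ k, z r k ∈ feasible S ∧ f₂ E S lam (z r k) ≤ f₂ E S lam z₀ := by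
    intro r h k
    induction k using Fin.induction with
    | zero => exact h
    | succ i ih =>
      exact ⟨(hz.update_mem r i).1, (hz.update_min r i (self_mem_coordSlice ih.1 i)).trans ih.2⟩
  induction r generalizing k with
  | zero => exact sweep 0 (by rw [hz.start]; exact ⟨hz₀, le_rfl⟩) k
  | succ r ih => exact sweep (r + 1) (by rw [hz.next_sweep]; exact ih _) k

theorem IsIterates.isSweep (hz : IsIterates E S lam z₀ z) (hz₀ : z₀ ∈ feasible S)
    (hfin : f₂ E S lam z₀ < ⊤) (r : ℕ) :
    IsSweep (euclideanMulVec E) (penalty S lam) (penaltyDomain S) (z r) where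
  mem k := f₂_lt_top_iff.1 ((hz.feasible_and_le hz₀ r k).2.trans_lt hfin)
  eq_of_ne i j hj := (hz.update_mem r i).2 j hj
  le_update i _ hs := le_update_of_isMinOn (hz.update_mem r i) (hz.update_min r i)
    (f₂_lt_top_iff.1 ((hz.feasible_and_le hz₀ r i.succ).2.trans_lt hfin)) hs

theorem existsUnique_isIterates (hlam : 0 ≤ lam) (hE : ∀ j : Fin n, ∃ i : Fin m, E i j ≠ 0)
    (hA5 : LevelSetsBounded E S lam) (hz₀ : z₀ ∈ feasible S) (hfin : f₂ E S lam z₀ < ⊤) :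
    ∃! z, IsIterates E S lam z₀ z := by
  -- The hypotheses sit under the existential so that `choose` yields a total update map, with `y`
  -- as default value.
  have hex : ∀ (y : Fin n → ℝ) (i : Fin n), ∃ w, y ∈ feasible S → f₂ E S lam y < ⊤ →
      w ∈ coordSlice S y i ∧ IsMinOn (f₂ E S lam) (coordSlice S y i) w := by
    intro y i
    by_cases h : y ∈ feasible S ∧ f₂ E S lam y < ⊤
    · obtain ⟨w, hw, hmin⟩ := exists_isMinOn_f₂ hA5 (isClosed_coordSlice y i)
        (fun _ h => h.1) (self_mem_coordSlice h.1 i) h.2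
      exact ⟨w, fun _ _ => ⟨hw, hmin⟩⟩
    · exact ⟨y, fun h1 h2 => (h ⟨h1, h2⟩).elim⟩
  choose step hstep using hex
  let sweep : (Fin n → ℝ) → Fin (n + 1) → Fin n → ℝ := fun y =>
    Fin.induction y fun i w => step w i
  let z : ℕ → Fin (n + 1) → Fin n → ℝ := fun r =>
    sweep ((fun y => sweep y (Fin.last n))^[r] z₀)
  have hsucc : ∀ r (i : Fin n), z r i.succ = step (z r i.castSucc) i := fun r i => rfl
  have hnext : ∀ r, z (r + 1) 0 = z r (Fin.last n) := fun r => by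
    change (fun y => sweep y (Fin.last n))^[r + 1] z₀ = _
    rw [Function.iterate_succ_apply']
  have hsweep : ∀ r, (z r 0 ∈ feasible S ∧ f₂ E S lam (z r 0) < ⊤) →
      ∀ k, z r k ∈ feasible S ∧ f₂ E S lam (z r k) < ⊤ := by
    intro r h k
    induction k using Fin.induction with
    | zero => exact h
    | succ i ih =>
      have hs := hstep _ i ih.1 ih.2
      rw [hsucc]
      exact ⟨hs.1.1, (hs.2 (self_mem_coordSlice ih.1 i)).trans_lt ih.2⟩
  have hgood : ∀ r k, z r k ∈ feasible S ∧ f₂ E S lam (z r k) < ⊤ := by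
    intro r
    induction r with
    | zero => exact hsweep 0 ⟨hz₀, hfin⟩
    | succ r ih => exact hsweep (r + 1) (by rw [hnext]; exact ih _)
  have hz : IsIterates E S lam z₀ z :=
    { start := rfl
      update_mem := fun r i => (hstep _ i (hgood r _).1 (hgood r _).2).1
      update_min := fun r i => (hstep _ i (hgood r _).1 (hgood r _).2).2
      next_sweep := hnext }
  refine ⟨z, hz, fun z' hz' => ?_⟩
  have hsame : ∀ r, z' r 0 = z r 0 → ∀ k, z' r k = z r k := by
    intro r h k
    induction k using Fin.induction with
    | zero => exact h
    | succ i ih =>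
      have hmem := hz'.update_mem r i
      have hmin := hz'.update_min r i
      rw [ih] at hmem hmin
      exact isMinOn_coordSlice_unique hlam hE (hgood r _).1 (hgood r _).2
        (hz.update_mem r i) (hz.update_min r i) hmem hmin
  have hall : ∀ r k, z' r k = z r k := by
    intro r
    induction r with
    | zero => exact hsame 0 (hz'.start.trans hz.start.symm)
    | succ r ih => exact hsame (r + 1) (by rw [hz'.next_sweep, hz.next_sweep, ih])
  exact funext fun r => funext fun k => hall r k

/-- For the logarithm the reference point is always `x₀ i`. For the absolute value the zero set of
the slack may be a half-line, so `s'` depends on `s`. -/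
theorem exists_slack_growth {x₀ : Fin n → ℝ} (hx₀ : ∀ i, x₀ i ∈ penaltyDomain S i) {ξ : ℝ}
    (hξ : 0 < ξ) (hx₀ξ : ∀ i, x₀ i ∈ levelBox S ξ i) (i : Fin n)
    (hslack : ∀ s ∈ penaltyDomain S i,
      0 ≤ slack (euclideanMulVec E) (penalty S lam) x₀ i s) :
    ∃ K : ℝ, 0 ≤ K ∧ ∀ s ∈ levelBox S ξ i, ∃ s' ∈ penaltyDomain S i,
      slack (euclideanMulVec E) (penalty S lam) x₀ i s' = 0 ∧
      (s - s') ^ 2 ≤ K * slack (euclideanMulVec E) (penalty S lam) x₀ i s := by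
  by_cases hi : i ∈ S
  · simp only [slack, penalty, penaltyDomain, hi, if_true, Set.mem_univ, true_imp_iff] at hslack
    obtain ⟨K, hK, h⟩ := abs_growth (ξ := ξ) hslack
    refine ⟨K, hK, fun s hs => ?_⟩
    simp only [levelBox, hi, if_true] at hs
    obtain ⟨s', h1, h2⟩ := h s (abs_le.2 hs)
    refine ⟨s', by simp [penaltyDomain, hi], ?_, ?_⟩ <;>
      simpa only [slack, penalty, hi, if_true]
  · refine ⟨4 * ξ ^ 2, by positivity, fun s hs => ⟨x₀ i, hx₀ i, slack_self _ _ _ _, ?_⟩⟩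
    have hspos := levelBox_subset hξ i hs
    have ha := hx₀ i
    have haξ := hx₀ξ i
    simp only [slack, penalty, penaltyDomain, levelBox, hi, if_false, Set.mem_Ioi]
      at hslack hspos hs ha haξ ⊢
    exact neg_log_growth ha hspos haξ.2 hs.2 hslack

end Iterates

end CCM

theorem theorem2p2 {m n : ℕ} (E : Matrix (Fin m) (Fin n) ℝ) (S : Finset (Fin n)) (lam : ℝ)
    (hlam : 0 < lam)
    (hE : ∀ j : Fin n, ∃ i : Fin m, E i j ≠ 0)
    (hA5 : CCM.LevelSetsBounded E S lam)
    (z₀ : Fin n → ℝ) (hz₀ : z₀ ∈ CCM.feasible S) (hfin : CCM.f₂ E S lam z₀ < ⊤) :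
    (∃! z : ℕ → Fin (n + 1) → (Fin n → ℝ), CCM.IsIterates E S lam z₀ z) ∧
    ∀ z : ℕ → Fin (n + 1) → (Fin n → ℝ), CCM.IsIterates E S lam z₀ z →
      ∃ zstar ∈ CCM.feasible S,
        Tendsto (fun r : ℕ => z r 0) atTop (𝓝 zstar) ∧
        ∀ x ∈ CCM.feasible S, CCM.f₂ E S lam zstar ≤ CCM.f₂ E S lam x := by
  open CCM in
  refine ⟨existsUnique_isIterates hlam.le hE hA5 hz₀ hfin, fun z hz => ?_⟩
  obtain ⟨x₀, hx₀f, hmin⟩ :=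
    exists_isMinOn_f₂ hA5 isClosed_feasible subset_rfl hz₀ hfin
  have hz₀I := f₂_lt_top_iff.1 hfin
  have hx₀I := f₂_lt_top_iff.1 ((hmin hz₀).trans_lt hfin)
  -- The level of `z₀` gives one box containing both the minimizer `x₀` and all iterates, so the
  -- growth constants are uniform in `r`.
  obtain ⟨ξ, hξ, hbox⟩ :=
    hA5.exists_levelBox (compositeObj (euclideanMulVec E) (penalty S lam) z₀)
  rw [← f₂_eq_coe hz₀I] at hbox
  have hconv := fun i => convexOn_penalty (S := S) hlam.le i
  have hminQ : ∀ x : Fin n → ℝ, (∀ i, x i ∈ penaltyDomain S i) →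
      compositeObj (euclideanMulVec E) (penalty S lam) x₀ ≤
        compositeObj (euclideanMulVec E) (penalty S lam) x := fun x hx => by
    have h : f₂ E S lam x₀ ≤ f₂ E S lam x := hmin (mem_feasible_of_domain hx)
    rwa [f₂_eq_coe hx₀I, f₂_eq_coe hx, EReal.coe_le_coe_iff] at h
  obtain ⟨x, hxD, hlim, hxQ⟩ := tendsto_of_isSweep hconv
    (fun i => (continuousOn_penalty i).mono (levelBox_subset hξ i))
    (fun i => (isCompact_levelBox ξ i).isClosed) (levelBox_subset hξ)
    (euclideanMulVec_single_ne_zero hE) hx₀I hminQ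
    (fun i => exists_slack_growth hx₀I hξ (hbox x₀ hx₀f (hmin hz₀)) i
      fun _ hs => slack_nonneg_of_isMin hconv hx₀I hminQ hs)
    (hz.isSweep hz₀ hfin) hz.next_sweep
    (fun r => hbox _ (hz.feasible_and_le hz₀ r 0).1 (hz.feasible_and_le hz₀ r 0).2)
  have hxI := fun i => levelBox_subset hξ i (hxD i)
  refine ⟨x, mem_feasible_of_domain hxI, hlim, fun y hy => ?_⟩
  rw [f₂_eq_coe hxI, hxQ, ← f₂_eq_coe hx₀I]
  exact hmin hy
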